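/- **Setting.** Let $M$ be a compact manifold, possibly with boundary, with Riemannian distance $\mathrm{dist}$ and normalized Lebesgue measure (Riemannian volume) $\mathrm{Leb}$. For a sequence $\bar x=(x_k)_{k\ge 0}$ in $M$ put $S_n(\bar x)=\frac1{n+1}\sum_{k=0}^n\delta_{x_k}$, and for a map $f$ and $p\in M$ let $S_n(p)=S_n\big((f^k(p))_{k\ge0}\big)$. A Borel probability measure $\mu$ on $M$ is *physical* for $f$ if it is $f$-invariant and the set of $p$ with $S_n(p)\to\mu$ (weak*) has full $\mathrm{Leb}$-measure (such a $\mu$ is unique). Let $(f_\alpha)_{\alpha\in\mathcal A}$ be a family of maps $M\to M$, each with a physical measure $\mu_\alpha$. Let $\varepsilon_0>0$, and for $\alpha\in\mathcal A$, $\varepsilon\in(0,\varepsilon_0)$ let $X_{\alpha,\varepsilon}$ be a homogeneous Markov chain on $M$ with transition kernel $P_{\alpha,\varepsilon}$ such that from every $x$ the chain jumps (with probability one) to a point at distance at most $\varepsilon$ from $f_\alpha(x)$, so that its realizations are $\varepsilon$-pseudotrajectories of $f_\alpha$, i.e. sequences with $\mathrm{dist}(f_\alpha(x_k),x_{k+1})\le\varepsilon$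 for all $k\ge0$. Let $\mu_{\alpha,\varepsilon}$ be a stationary probability measure of $X_{\alpha,\varepsilon}$ which is ergodic: $S_n(\bar x)\to\mu_{\alpha,\varepsilon}$ (weak*) for almost every realization $\bar x$ of the chain started from $\mu_{\alpha,\varepsilon}$. Let $\sigma:[0,\infty)\to[0,\infty)$ satisfy $\sigma(\varepsilon)\to0$ as $\varepsilon\to0^+$ and $\sigma(\varepsilon)>0$ for $0<\varepsilon<\varepsilon_0$. Let $\mathfrak B$ be a class of functions $M\to\mathbb R$ and $\mathfrak B_C=\mathfrak B\cap C(M)$ (for example $\mathfrak B_C=C(M)$). **Theorem.** Assume that the family has *uniform stochastic stability with speed $\sigma$ for observables from $\mathfrak B_C$*: for every $\varphi\in\mathfrak B_C$ there is a constant $C(\varphi)$ with $$\Big|\int\varphi\,d\mu_\alpha-\int\varphi\,d\mu_{\alpha,\varepsilon}\Big|\le C(\varphi)\,\sigma(\varepsilon)\qquad\text{for all }\alpha\in\mathcal A,\ 0<\varepsilon<\varepsilon_0 .$$ Assume further that for every $\alpha\in\mathcal A$: * $f_\alpha$ is continuous; * $f=f_\alpha$ has the *specification property*: for every $\delta>0$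 there is $N$ such that for all $x_1,x_2\in M$, all integers $0\le a_1\le b_1$, $0\le a_2\le b_2$ with $a_2-b_1>N$, and all integers $p>b_2-a_1+N$ there is $x\in M$ with $f^p(x)=x$, $\mathrm{dist}(f^i(x),f^i(x_1))<\delta$ for $a_1\le i\le b_1$, and $\mathrm{dist}(f^i(x),f^i(x_2))<\delta$ for $a_2\le i\le b_2$; * $\mu_\alpha$ is not a finite sum (with weights) of $\delta$-measures; * for every $\varepsilon\in(0,\varepsilon_0)$ the measure $\mu_{\alpha,\varepsilon}$ has *exponential decay of correlations for observables from $\mathfrak B_C$*: there is $\tau\in(0,1)$ such that for every $\tau'>\tau$ and all $\varphi,\psi\in\mathfrak B_C$ there is a constant $C$ with $$\Big|\int\Big(\int\varphi(y)\,P^n_{\alpha,\varepsilon}(x,dy)\Big)\psi(x)\,d\mu_{\alpha,\varepsilon}(x)-\int\varphi\,d\mu_{\alpha,\varepsilon}\int\psi\,d\mu_{\alpha,\varepsilon}\Big|\le C(\tau')^n,\qquad n\in\mathbb N .$$ Then the family has *uniform stochastic shadowing with accuracy $\sigma$ for observables from $\mathfrak B_C$*: for every $\varphi\in\mathfrak B_C$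 there is a constant $C(\varphi)$ such that for all $\alpha\in\mathcal A$ and $0<\varepsilon<\varepsilon_0$ there are measurable sets $B_N$ ($N\in\mathbb N$) of $\varepsilon$-pseudotrajectories of $f_\alpha$ (realizations of $X_{\alpha,\varepsilon}$), whose probability under the chain started from $\mu_{\alpha,\varepsilon}$ tends to $1$ as $N\to\infty$, with the following property: for every $N$ and every $\bar x\in B_N$ there is a point $p\in M$ such that for all $n>N$ $$\Big|\int\varphi\,dS_n(\bar x)-\int\varphi\,d\mu_{\alpha,\varepsilon}\Big|\le C(\varphi)\sigma(\varepsilon),\quad \Big|\int\varphi\,dS_n(p)-\int\varphi\,d\mu_\alpha\Big|\le C(\varphi)\sigma(\varepsilon),\quad \Big|\int\varphi\,dS_n(\bar x)-\int\varphi\,dS_n(p)\Big|\le C(\varphi)\sigma(\varepsilon).$$ -/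

import Mathlib

open MeasureTheory ProbabilityTheory Filter Topology
open scoped NNReal ENNReal Manifold ContDiff Bundle MeasureTheory

noncomputable section

namespace StochShadow

/-! ### Reference measure -/

/-- The normalized Lebesgue measure (normalized Riemannian volume) of a compact manifold `M` modelled
on `E`. On a Riemannian manifold of dimension `d` the `d`-dimensional Hausdorff measure of the
Riemannian distance is a constant (depending on `d` only) times the Riemannian volume, so after
normalization the two agree. -/
def normalizedLebesgue (E M : Type*) [NormedAddCommGroup E] [NormedSpace ℝ E] [MetricSpace M]
    [MeasurableSpace M] [BorelSpace M] : Measure M :=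
  (μH[(Module.finrank ℝ E : ℝ)] (Set.univ : Set M))⁻¹ • μH[(Module.finrank ℝ E : ℝ)]

/-! ### Empirical measures and physical measures -/

/-- The measure `(1 / (n + 1)) * ∑_{k = 0}^{n} δ_{x k}`. -/
def empiricalMeasure {M : Type*} [MeasurableSpace M] (x : ℕ → M) (n : ℕ) : Measure M :=
  ((n : ℝ≥0∞) + 1)⁻¹ • ∑ k ∈ Finset.range (n + 1), Measure.dirac (x k)

theorem empiricalMeasure_isProbabilityMeasure {M : Type*} [MeasurableSpace M]
    (x : ℕ → M) (n : ℕ) : IsProbabilityMeasure (empiricalMeasure x n) := by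
  constructor
  have h : (((n + 1 : ℕ) : ℝ≥0∞))⁻¹ * ((n + 1 : ℕ) : ℝ≥0∞) = 1 :=
    ENNReal.inv_mul_cancel (by simp) (ENNReal.natCast_ne_top _)
  simpa [empiricalMeasure] using h

section General

variable {M : Type*} [MetricSpace M] [MeasurableSpace M] [BorelSpace M]

/-- The empirical measure `S_n(x)` of the first `n + 1` terms of the sequence `x`. -/
def S (n : ℕ) (x : ℕ → M) : ProbabilityMeasure M :=
  ⟨empiricalMeasure x n, empiricalMeasure_isProbabilityMeasure x n⟩

/-- The trajectory `p, f p, f (f p), …`. -/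
def orbit (f : M → M) (p : M) : ℕ → M := fun k => f^[k] p

/-- `|∫ φ dμ - ∫ φ dν|`. -/
def obsDist (φ : M → ℝ) (μ ν : ProbabilityMeasure M) : ℝ :=
  |(∫ y, φ y ∂(μ : Measure M)) - ∫ y, φ y ∂(ν : Measure M)|

/-- `p` is typical for `μ`: the empirical measures of its orbit converge to `μ` in the weak*
topology. -/
def IsTypical (f : M → M) (μ : ProbabilityMeasure M) (p : M) : Prop :=
  Tendsto (fun n => S n (orbit f p)) atTop (𝓝 μ)

/-- `μ` is an invariant Borel probability measure whose set of typical points has full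
normalized Lebesgue measure. -/
structure IsPhysical (E : Type*) [NormedAddCommGroup E] [NormedSpace ℝ E]
    (f : M → M) (μ : ProbabilityMeasure M) : Prop where
  invariant : MeasurePreserving f (μ : Measure M) (μ : Measure M)
  full_measure : normalizedLebesgue E M {p | IsTypical f μ p} = 1

/-- `μ` is a finite linear combination of `δ`-measures. -/
def IsFiniteSumOfDiracs (μ : ProbabilityMeasure M) : Prop :=
  ∃ (s : Finset M) (c : M → ℝ≥0∞), (μ : Measure M) = ∑ p ∈ s, c p • Measure.dirac p

/-! ### Specification -/

/-- The specification property for two orbit segments, with times in the strings `[a₁, b₁]` and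
`[a₂, b₂]`. -/
def HasSpecification (f : M → M) : Prop :=
  ∀ δ : ℝ, 0 < δ → ∃ N : ℕ, ∀ (x₁ x₂ : M) (a₁ b₁ a₂ b₂ : ℕ), a₁ ≤ b₁ → a₂ ≤ b₂ →
    b₁ + N < a₂ → ∀ p : ℕ, b₂ + N < p + a₁ →
      ∃ x : M, Function.IsPeriodicPt f p x ∧
        (∀ i ∈ Set.Icc a₁ b₁, dist (f^[i] x) (f^[i] x₁) < δ) ∧
        (∀ i ∈ Set.Icc a₂ b₂, dist (f^[i] x) (f^[i] x₂) < δ)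

/-! ### Markov chains

A homogeneous Markov chain on `M` is given by its transition kernel `P`, `P x E` being the
probability to jump from `x` into `E`. Its realizations are sequences in `M`. -/

/-- `x` is an `ε`-pseudotrajectory of `f`. -/
def IsPseudotrajectory (f : M → M) (ε : ℝ) (x : ℕ → M) : Prop :=
  ∀ k, dist (f (x k)) (x (k + 1)) ≤ ε

/-- From every state `x` the chain jumps into the closed `ε`-ball around `f x` (with
probability one), so that its realizations are `ε`-pseudotrajectories of `f`. -/
def IsAdmissible (f : M → M) (P : Kernel M M) (ε : ℝ) : Prop :=
  ∀ x, P x (Metric.closedBall (f x) ε) = 1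

/-- The law on the space of sequences of the Markov chain with transition kernel `P` and initial
distribution `ν`. -/
def pathLaw (P : Kernel M M) [IsMarkovKernel P] (ν : ProbabilityMeasure M) : Measure (ℕ → M) :=
  Kernel.trajMeasure (X := fun _ => M) (ν : Measure M)
    (fun n => P.comap (fun h : (Π _ : Finset.Iic n, M) => h ⟨n, Finset.mem_Iic.2 le_rfl⟩)
      (measurable_pi_apply _))

/-- `ν` is stationary for the chain and, for almost every realization `x` of the chain started
from `ν`, the empirical measures of `x` converge to `ν` in the weak* topology. -/
structure IsErgodicStationary (P : Kernel M M) [IsMarkovKernel P] (ν : ProbabilityMeasure M) :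
    Prop where
  stationary : ∀ B : Set M, MeasurableSet B → (ν : Measure M) B = ∫⁻ x, P x B ∂(ν : Measure M)
  ergodic : ∀ᵐ x ∂(pathLaw P ν), Tendsto (fun n => S n x) atTop (𝓝 ν)

/-- Exponential decay of correlations of the stationary measure `ν` for observables from `𝓑`;
`P ^ n` is the `n`-step transition kernel. -/
def HasExpDecay (𝓑 : Set (M → ℝ)) (P : Kernel M M) (ν : ProbabilityMeasure M) : Prop :=
  ∃ τ : ℝ, 0 < τ ∧ τ < 1 ∧ ∀ τ' : ℝ, τ < τ' → ∀ φ ∈ 𝓑, ∀ ψ ∈ 𝓑, ∃ C : ℝ, ∀ n : ℕ,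
    |(∫ x, (∫ y, φ y ∂((P ^ n) x)) * ψ x ∂(ν : Measure M)) -
      (∫ x, φ x ∂(ν : Measure M)) * ∫ x, ψ x ∂(ν : Measure M)| ≤ C * τ' ^ n

/-! ### Stochastic stability and stochastic shadowing

`ε` ranges over `(0, ε₀)`; `ν ε` is the stationary measure of the chain `P ε`. -/

/-- Stochastic stability with speed `σ` for the observable `φ`, with constant `C`. -/
def StableWith {ε₀ : ℝ≥0} (μ : ProbabilityMeasure M) (ν : Set.Ioo 0 ε₀ → ProbabilityMeasure M)
    (σ : ℝ≥0 → ℝ≥0) (φ : M → ℝ) (C : ℝ) : Prop :=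
  ∀ ε : Set.Ioo 0 ε₀, obsDist φ μ (ν ε) ≤ C * σ ε

/-- Stochastic shadowing with accuracy `σ` for the observable `φ`, with constant `C`: for every `ε`
there are (measurable) sets `B N` of realizations of the chain `P ε`, with probability tending to
one, such that every element of `B N` is shadowed, in the sense of averages of `φ` over every number
`n > N` of steps, by some exact trajectory. -/
def ShadowsWith {ε₀ : ℝ≥0} (f : M → M) (μ : ProbabilityMeasure M)
    (P : Set.Ioo 0 ε₀ → Kernel M M) [∀ ε, IsMarkovKernel (P ε)]
    (ν : Set.Ioo 0 ε₀ → ProbabilityMeasure M) (σ : ℝ≥0 → ℝ≥0) (φ : M → ℝ) (C : ℝ) : Prop :=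
  ∀ ε : Set.Ioo 0 ε₀, ∃ B : ℕ → Set (ℕ → M),
    (∀ N, MeasurableSet (B N)) ∧
    (∀ N, ∀ x ∈ B N, IsPseudotrajectory f (ε : ℝ≥0) x) ∧
    (∀ N, ∀ x ∈ B N, ∃ p : M, ∀ n, N < n →
      obsDist φ (S n x) (ν ε) ≤ C * σ ε ∧
      obsDist φ (S n (orbit f p)) μ ≤ C * σ ε ∧
      obsDist φ (S n x) (S n (orbit f p)) ≤ C * σ ε) ∧
    Tendsto (fun N => pathLaw (P ε) (ν ε) (B N)) atTop (𝓝 1)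

/-- Uniform stochastic stability: the constant depends only on the observable, not on the
parameter `α`. -/
def UniformStochasticStability {A : Type*} {ε₀ : ℝ≥0} (𝓑 : Set (M → ℝ))
    (μ : A → ProbabilityMeasure M) (ν : A → Set.Ioo 0 ε₀ → ProbabilityMeasure M)
    (σ : ℝ≥0 → ℝ≥0) : Prop :=
  ∀ φ ∈ 𝓑, ∃ C : ℝ, ∀ α, StableWith (μ α) (ν α) σ φ C

/-- Uniform stochastic shadowing: the constant depends only on the observable, not on the
parameters `α` and `ε` or on `N`. -/
def UniformStochasticShadowing {A : Type*} {ε₀ : ℝ≥0} (𝓑 : Set (M → ℝ))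
    (f : A → M → M) (μ : A → ProbabilityMeasure M)
    (P : A → Set.Ioo 0 ε₀ → Kernel M M) [∀ α ε, IsMarkovKernel (P α ε)]
    (ν : A → Set.Ioo 0 ε₀ → ProbabilityMeasure M) (σ : ℝ≥0 → ℝ≥0) : Prop :=
  ∀ φ ∈ 𝓑, ∃ C : ℝ, ∀ α, ShadowsWith (f α) (μ α) (P α) (ν α) σ φ C

/-- The continuous observables of the class `𝓑`. -/
def continuousPart (𝓑 : Set (M → ℝ)) : Set (M → ℝ) := {φ | φ ∈ 𝓑 ∧ Continuous φ}

end General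

end StochShadow

end

/-!
Shadowing in the sense of averages follows from a triangle inequality through the two measures
`μ_α` and `μ_{α,ε}`. Fix a continuous observable `φ` and parameters `α`, `ε`.

* Almost every realization `x` of the chain is an `ε`-pseudotrajectory
  (`ae_isPseudotrajectory`: every single jump is admissible, and the joint law of the past and the
  next state is the composition-product with the transition kernel). Ergodicity makes the averages
  of `φ` along almost every `x` converge to `∫ φ dμ_{α,ε}`.
* Some point `p` is typical for the physical measure `μ_α`, since the set of such points has
  measure one. The averages of `φ` along its orbit converge to `∫ φ dμ_α`.
* By stochastic stability the two limits differ by at most `C σ(ε)`.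

As `σ(ε) > 0`, both averages are eventually within `σ(ε)` of their limits, hence within
`(C + 2) σ(ε)` of each other. The set `B_N` consists of the pseudotrajectories for which
"eventually" means "from time `N + 1` on" in both averages; it is empty as long as `N` is too small
for the orbit of `p`. These sets increase to a set of full probability, so
their probabilities tend to one. The constant is taken to be `|C| + 2`, so that it also covers the
two other estimates. It depends on the stability constant alone, hence is uniform in `α` and `ε`;
only the sets `B_N` and the point `p` depend on the parameters.
-/

open MeasureTheory ProbabilityTheory Filter Topology
open scoped NNReal ENNReal

namespace StochShadow

theorem obsDist_triangle {M : Type*} [MeasurableSpace M] (φ : M → ℝ)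
    (μ₁ μ₂ μ₃ : ProbabilityMeasure M) :
    obsDist φ μ₁ μ₃ ≤ obsDist φ μ₁ μ₂ + obsDist φ μ₂ μ₃ :=
  abs_sub_le _ _ _

theorem obsDist_comm {M : Type*} [MeasurableSpace M] (φ : M → ℝ) (μ₁ μ₂ : ProbabilityMeasure M) :
    obsDist φ μ₁ μ₂ = obsDist φ μ₂ μ₁ :=
  abs_sub_comm _ _

variable {M : Type*} [MetricSpace M] [MeasurableSpace M] [BorelSpace M]

/-- Compactness of `M` makes `φ` a bounded test function for weak* convergence. -/
theorem tendsto_obsDist [CompactSpace M] {φ : M → ℝ} (hφ : Continuous φ)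
    {u : ℕ → ProbabilityMeasure M} {μ : ProbabilityMeasure M} (h : Tendsto u atTop (𝓝 μ)) :
    Tendsto (fun n => obsDist φ (u n) μ) atTop (𝓝 0) := by
  have h1 := ProbabilityMeasure.tendsto_iff_forall_integral_tendsto.1 h
    (BoundedContinuousFunction.mkOfCompact ⟨φ, hφ⟩)
  have h2 := (h1.sub_const (∫ y, φ y ∂(μ : Measure M))).abs
  simpa [obsDist] using h2

theorem integral_S (φ : M → ℝ) (n : ℕ) (x : ℕ → M) :
    ∫ y, φ y ∂(S n x : Measure M) = ((n : ℝ) + 1)⁻¹ * ∑ k ∈ Finset.range (n + 1), φ (x k) := by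
  have h : (S n x : Measure M) = empiricalMeasure x n := rfl
  rw [h, empiricalMeasure, integral_smul_measure,
    integral_finsetSum_measure fun k _ => integrable_dirac (by simp)]
  simp [ENNReal.toReal_add, ENNReal.toReal_inv]

theorem continuous_obsDist_S {φ : M → ℝ} (hφ : Continuous φ) (n : ℕ) (μ : ProbabilityMeasure M) :
    Continuous fun x : ℕ → M => obsDist φ (S n x) μ := by
  simp only [obsDist, integral_S]
  fun_prop

theorem isClosed_setOf_isPseudotrajectory {M : Type*} [MetricSpace M] {f : M → M}
    (hf : Continuous f) (ε : ℝ) :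
    IsClosed {x : ℕ → M | IsPseudotrajectory f ε x} := by
  simp only [IsPseudotrajectory, Set.ofPred_forall]
  exact isClosed_iInter fun k => isClosed_le (by fun_prop) continuous_const

instance isProbabilityMeasure_pathLaw {M : Type*} [MeasurableSpace M] (P : Kernel M M)
    [IsMarkovKernel P] (ν : ProbabilityMeasure M) : IsProbabilityMeasure (pathLaw P ν) := by
  unfold pathLaw
  infer_instance

/-- A property that almost every jump of the chain has holds along almost every realization, at any
given time. -/
theorem ae_pathLaw_of_forall_ae {M : Type*} [MeasurableSpace M] (P : Kernel M M)
    [IsMarkovKernel P] (ν : ProbabilityMeasure M)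
    {p : M × M → Prop} (hp : MeasurableSet {z | p z}) (h : ∀ x, ∀ᵐ y ∂(P x), p (x, y)) (k : ℕ) :
    ∀ᵐ x ∂(pathLaw P ν), p (x k, x (k + 1)) := by
  have hmeas : MeasurableSet {z : (Π _ : Finset.Iic k, M) × M |
      p (z.1 ⟨k, Finset.mem_Iic.2 le_rfl⟩, z.2)} :=
    hp.preimage (f := fun z : (Π _ : Finset.Iic k, M) × M =>
      (z.1 ⟨k, Finset.mem_Iic.2 le_rfl⟩, z.2)) (by fun_prop)
  have hlaw := Kernel.map_frestrictLe_trajMeasure_compProd_eq_map_trajMeasure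
    (X := fun _ => M) (μ₀ := (ν : Measure M)) (a := k)
    (κ := fun n => P.comap (fun h : (Π _ : Finset.Iic n, M) => h ⟨n, Finset.mem_Iic.2 le_rfl⟩)
      (measurable_pi_apply _))
  have hae := (Measure.ae_compProd_iff (κ := P.comap
    (fun h : (Π _ : Finset.Iic k, M) => h ⟨k, Finset.mem_Iic.2 le_rfl⟩) (measurable_pi_apply _))
      hmeas).2
    (ae_of_all ((pathLaw P ν).map (Preorder.frestrictLe k))
      fun z => h (z ⟨k, Finset.mem_Iic.2 le_rfl⟩))
  have hpath := ae_of_ae_map (by fun_prop) (hlaw ▸ hae)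
  exact hpath

theorem ae_isPseudotrajectory [SecondCountableTopology M] {f : M → M} (hf : Continuous f)
    {P : Kernel M M} [IsMarkovKernel P] (ν : ProbabilityMeasure M) {ε : ℝ}
    (hP : IsAdmissible f P ε) :
    ∀ᵐ x ∂(pathLaw P ν), IsPseudotrajectory f ε x := by
  refine ae_all_iff.2 fun k => ae_pathLaw_of_forall_ae P ν (p := fun z => dist (f z.1) z.2 ≤ ε)
    (isClosed_le (by fun_prop) continuous_const).measurableSet (fun x => ?_) k
  have h := (prob_compl_eq_zero_iff Metric.isClosed_closedBall.measurableSet).2 (hP x)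
  filter_upwards [compl_mem_ae_iff.2 h] with y hy
  rw [compl_compl, Metric.mem_closedBall, dist_comm] at hy
  exact hy

theorem IsPhysical.exists_isTypical {E : Type*} [NormedAddCommGroup E] [NormedSpace ℝ E]
    {f : M → M} {μ : ProbabilityMeasure M} (h : IsPhysical E f μ) : ∃ p, IsTypical f μ p := by
  by_contra! hne
  have hempty : {p | IsTypical f μ p} = ∅ := Set.eq_empty_of_forall_notMem hne
  simpa [hempty] using h.full_measure

/-- If almost every `x` satisfies `p n x` for all large `n`, then the probability that `p n x` holds
for every `n > N` tends to one as `N → ∞`. -/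
theorem tendsto_measure_forall_gt {Ω : Type*} [MeasurableSpace Ω] (m : Measure Ω)
    [IsProbabilityMeasure m] {p : ℕ → Ω → Prop} (h : ∀ᵐ x ∂m, ∀ᶠ n in atTop, p n x) :
    Tendsto (fun N => m {x | ∀ n, N < n → p n x}) atTop (𝓝 1) := by
  have hmono : Monotone fun N => {x | ∀ n, N < n → p n x} :=
    fun N N' hN x hx n hn => hx n (hN.trans_lt hn)
  have hunion : m (⋃ N, {x | ∀ n, N < n → p n x}) = 1 := by
    rw [← measure_univ (μ := m)]
    refine measure_congr (eventuallyEq_univ.2 ?_)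
    filter_upwards [h] with x hx
    obtain ⟨N, hN⟩ := eventually_atTop.1 hx
    exact Set.mem_iUnion.2 ⟨N, fun n hn => hN n hn.le⟩
  exact hunion ▸ tendsto_measure_iUnion_atTop hmono

/-- For a single map, stability of `φ` with constant `C` gives shadowing of `φ` with constant
`|C| + 2`: one `σ ε` for each of the two averages, and `C * σ ε` for the distance of their
limits. -/
theorem StableWith.shadowsWith [CompactSpace M] {ε₀ : ℝ≥0} {f : M → M}
    {μ : ProbabilityMeasure M} {P : Set.Ioo 0 ε₀ → Kernel M M} [∀ ε, IsMarkovKernel (P ε)]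
    {ν : Set.Ioo 0 ε₀ → ProbabilityMeasure M} {σ : ℝ≥0 → ℝ≥0} {φ : M → ℝ} {C : ℝ}
    (hstab : StableWith μ ν σ φ C) (hf : Continuous f) (hφ : Continuous φ)
    (htyp : ∃ p, IsTypical f μ p)
    (hP : ∀ ε : Set.Ioo 0 ε₀, IsAdmissible f (P ε) (ε : ℝ≥0))
    (hν : ∀ ε, IsErgodicStationary (P ε) (ν ε)) (hσ : ∀ ε : Set.Ioo 0 ε₀, 0 < σ ε) :
    ShadowsWith f μ P ν σ φ (|C| + 2) := by
  intro ε
  obtain ⟨p, hp⟩ := htyp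
  have hσε : (0 : ℝ) < σ ε := NNReal.coe_pos.2 (hσ ε)
  have hC : C * σ ε ≤ |C| * σ ε := mul_le_mul_of_nonneg_right (le_abs_self C) hσε.le
  have hC0 : 0 ≤ |C| * σ ε := mul_nonneg (abs_nonneg C) hσε.le
  -- The orbit of `p` does not depend on `x`; its condition makes `N` large enough for `p` as well.
  let good : ℕ → (ℕ → M) → Prop := fun n x =>
    IsPseudotrajectory f (ε : ℝ≥0) x ∧ obsDist φ (S n x) (ν ε) ≤ σ ε ∧
      obsDist φ (S n (orbit f p)) μ ≤ σ ε
  refine ⟨fun N => {x | ∀ n, N < n → good n x}, fun N => ?_, fun N x hx => ?_, fun N x hx => ?_, ?_⟩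
  · have hclosed : ∀ n, IsClosed {x | good n x} := fun n =>
      (isClosed_setOf_isPseudotrajectory hf _).inter
        ((isClosed_le (continuous_obsDist_S hφ n _) continuous_const).inter isClosed_const)
    simp only [Set.ofPred_forall]
    exact .iInter fun n => .iInter fun _ => (hclosed n).measurableSet
  · exact (hx (N + 1) N.lt_succ_self).1
  · refine ⟨p, fun n hn => ?_⟩
    obtain ⟨-, h1, h2⟩ := hx n hn
    have h3 : obsDist φ (ν ε) μ ≤ C * σ ε := obsDist_comm φ μ (ν ε) ▸ hstab ε
    have h4 := obsDist_triangle φ (S n x) (ν ε) (S n (orbit f p))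
    have h5 := obsDist_triangle φ (ν ε) μ (S n (orbit f p))
    rw [obsDist_comm φ μ (S n (orbit f p))] at h5
    exact ⟨by linarith, by linarith, by linarith⟩
  · refine tendsto_measure_forall_gt _ ?_
    filter_upwards [ae_isPseudotrajectory hf (ν ε) (hP ε), (hν ε).ergodic] with x hx hxν
    filter_upwards [(tendsto_obsDist hφ hxν).eventually_le_const hσε,
      (tendsto_obsDist hφ hp).eventually_le_const hσε] with n h1 h2
    exact ⟨hx, h1, h2⟩

end StochShadow

theorem mainTheorem9
    {E : Type*} [NormedAddCommGroup E] [NormedSpace ℝ E] [FiniteDimensional ℝ E]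
    {H : Type*} [TopologicalSpace H] (I : ModelWithCorners ℝ E H)
    {M : Type*} [MetricSpace M] [CompactSpace M] [MeasurableSpace M] [BorelSpace M]
    [ChartedSpace H M] [IsManifold I 1 M]
    [Bundle.RiemannianBundle (fun x : M => TangentSpace I x)]
    [IsContinuousRiemannianBundle E (fun x : M => TangentSpace I x)]
    [IsRiemannianManifold I M]
    {A : Type*} {ε₀ : ℝ≥0}
    (f : A → M → M) (μ : A → ProbabilityMeasure M)
    (P : A → Set.Ioo 0 ε₀ → Kernel M M) [∀ α ε, IsMarkovKernel (P α ε)]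
    (ν : A → Set.Ioo 0 ε₀ → ProbabilityMeasure M)
    (σ : ℝ≥0 → ℝ≥0) (𝓑 : Set (M → ℝ))
    -- standing assumptions
    (hμ : ∀ α, StochShadow.IsPhysical E (f α) (μ α))
    (hP : ∀ α (ε : Set.Ioo 0 ε₀), StochShadow.IsAdmissible (f α) (P α ε) (ε : ℝ≥0))
    (hν : ∀ α ε, StochShadow.IsErgodicStationary (P α ε) (ν α ε))
    (hσ : Tendsto σ (𝓝[>] 0) (𝓝 0))
    (hσ_pos : ∀ ε : Set.Ioo 0 ε₀, 0 < σ ε)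
    -- assumptions of the theorem
    (hstab : StochShadow.UniformStochasticStability (StochShadow.continuousPart 𝓑) μ ν σ)
    (hcont : ∀ α, Continuous (f α))
    (hspec : ∀ α, StochShadow.HasSpecification (f α))
    (hatoms : ∀ α, ¬ StochShadow.IsFiniteSumOfDiracs (μ α))
    (hdecay : ∀ α ε, StochShadow.HasExpDecay (StochShadow.continuousPart 𝓑) (P α ε) (ν α ε)) :
    StochShadow.UniformStochasticShadowing (StochShadow.continuousPart 𝓑) f μ P ν σ := by
  intro φ hφ
  obtain ⟨C, hC⟩ := hstab φ hφ
  exact ⟨|C| + 2, fun α => (hC α).shadowsWith (hcont α) hφ.2 (hμ α).exists_isTypical (hP α) (hν α)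
    hσ_pos⟩
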